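/- Let $F$ be $\mathbb{R}$ or $\mathbb{C}$, let $n\ge 3$, and let $M_n(F)$ be the algebra of $n\times n$ matrices over $F$. A square matrix $T$ over $F$ (of any size) is called quadratic if there are complex numbers $a,b$ with $(T-aI)(T-bI)=0$, where $T$ is regarded as a complex matrix. For a map $\varphi: M_n(F)\to M_n(F)$ and an integer $m\ge 1$, let $\varphi_m$ be the map on $m\times m$ block matrices with blocks in $M_n(F)$ given by $\varphi_m\big((T_{ij})_{i,j=1}^m\big)=(\varphi(T_{ij}))_{i,j=1}^m$; block matrices are regarded as $mn\times mn$ matrices over $F$. The map $\varphi$ is called $m$-quadratic preserving in both directions if, for every such block matrix $X$, $X$ is quadratic if and only if $\varphi_m(X)$ is quadratic. Theorem. Let $\varphi: M_n(F)\to M_n(F)$ be a bijection. The following statements are equivalent: 1. $\varphi$ completely preserves quadratic matrices in both directions, that is, $\varphi$ is $m$-quadratic preserving in both directions for every $m\ge 1$. 2. $\varphi$ is $2$-quadratic preserving in both directions. 3. There exist an invertible matrix $A\in M_n(F)$, a scalar $\lambda\in F$ and a field automorphism $\tau: F\to F$ such that $\varphi(T)=\lambda A T_\tau A^{-1}$ for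 all $T\in M_n(F)$, where $T_\tau=(\tau(t_{ij}))$ for $T=(t_{ij})$. -/

import Mathlib

/-- A square matrix `T` over the real or complex field `F` is *quadratic* if
`(T - a I) (T - b I) = 0` for some complex numbers `a` and `b`, the entries of `T` being regarded
as complex numbers. `RCLike.map F ℂ` is the inclusion of `ℝ` in `ℂ` for `F = ℝ` and the identity
for `F = ℂ`. -/
def IsQuadraticMatrix {F : Type*} [RCLike F] {ι : Type*} [Fintype ι] [DecidableEq ι]
    (T : Matrix ι ι F) : Prop :=
  ∃ a b : ℂ, (T.map (RCLike.map F ℂ) - a • (1 : Matrix ι ι ℂ)) *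
    (T.map (RCLike.map F ℂ) - b • (1 : Matrix ι ι ℂ)) = 0

/-- The map `φ` is `m`-quadratic preserving in both directions: for every `m × m` block matrix
`X` with blocks in `M_n(F)`, the matrix `X` is quadratic if and only if the block matrix
`φ_m X = (φ (X i j))` is. `Matrix.comp` reads a block matrix as a matrix over `F`. -/
def PreservesQuadratic {F : Type*} [RCLike F] {n : ℕ} (m : ℕ)
    (φ : Matrix (Fin n) (Fin n) F → Matrix (Fin n) (Fin n) F) : Prop :=
  ∀ X : Matrix (Fin m) (Fin m) (Matrix (Fin n) (Fin n) F),
    IsQuadraticMatrix (Matrix.comp (Fin m) (Fin m) (Fin n) (Fin n) F X) ↔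
      IsQuadraticMatrix (Matrix.comp (Fin m) (Fin m) (Fin n) (Fin n) F (X.map φ))

/-- The map `φ` completely preserves quadratic matrices in both directions. -/
def CompletelyPreservesQuadratic {F : Type*} [RCLike F] {n : ℕ}
    (φ : Matrix (Fin n) (Fin n) F → Matrix (Fin n) (Fin n) F) : Prop :=
  ∀ m : ℕ, 1 ≤ m → PreservesQuadratic m φ

/-!
Writing out when a `2 × 2` block matrix `(A, B; C, D)` satisfies `X ^ 2 = s X + p` gives four matrix
equations (`BlockQuadratic`), and suitable choices of the blocks translate the hypothesis on `φ` into
algebra.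

The block `0` is the only `Z` for which all `(Z, Y; Z, Z)` are quadratic, and `A` is a scalar as soon
as `(A, 1; 0, 0)` is quadratic. So `φ 0 = 0` and, after division by a scalar, `φ 1 = 1`
(`exists_smul_isUnitalPreserver`). The block matrices `(P, 0; 0, 1)`, `(P, P; 0, 0)` and
`(P, B; 0, 1)` show that `φ` preserves idempotents `P` and the relations `P B = 0`, hence inclusion
of column spaces and, by transposition, of row spaces. Consequently `φ` permutes the matrices of
rank one, and it acts on them by `φ (y ⊗ g) = a y ⊗ b g`
(`IsUnitalPreserver.exists_map_vecMulVec`), the scalar factor being controlled by the block matrix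
`(x₀ ⊗ f₀, x₀ ⊗ g; y ⊗ f₀, y ⊗ g)`.

The fundamental theorem of projective geometry is not needed to make `a` and `b` semilinear. The
block matrix `(x ⊗ f, 0; 0, y ⊗ g)`, for nonzero vectors, is quadratic exactly when `f x = g y`, so
`(b g) (a y) = τ (g y)` for a function `τ` on the field. Evaluating on a basis and its dual basis
gives `a y = A τ(y)` and `b g = τ(g) A⁻¹`, whence `τ (∑ g_i y_i) = ∑ τ (g_i) τ (y_i)`, and `τ` is a
field automorphism (`IsUnitalPreserver.exists_ringEquiv_map_vecMulVec`).

Finally, if `f (T y) = 1` then `(T y ⊗ f, T; -y ⊗ f, -y ⊗ f T)` has square zero. Three of its blocks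
have rank at most one, so their images are known, and the image can only be quadratic if
`(b f) (φ T) = b (f T)`. This determines `φ T` (`IsUnitalPreserver.exists_similarity`).
-/

open Matrix

/-! ### Rank-one matrices -/

section RankOneMatrices

variable {K ι : Type*} [Field K]

/-- A matrix of rank at most one is not a nonzero scalar. -/
lemma eq_zero_of_vecMulVec_eq_smul_one [DecidableEq ι] [Nontrivial ι] {u v : ι → K} {p : K}
    (h : vecMulVec u v = p • (1 : Matrix ι ι K)) : p = 0 := by
  obtain ⟨i, j, hij⟩ := exists_pair_ne ι
  have h1 : u i * v j = 0 := by
    simpa [vecMulVec_apply, hij] using congrFun (congrFun h i) j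
  have h2 : u i * v i = p := by simpa [vecMulVec_apply] using congrFun (congrFun h i) i
  have h3 : u j * v j = p := by simpa [vecMulVec_apply] using congrFun (congrFun h j) j
  rcases mul_eq_zero.1 h1 with h0 | h0
  · rw [← h2, h0, zero_mul]
  · rw [← h3, h0, mul_zero]

lemma dotProduct_eq_one_of_isIdempotent [Fintype ι] {u v : ι → K} (hu : u ≠ 0) (hv : v ≠ 0)
    (h : vecMulVec u v * vecMulVec u v = vecMulVec u v) : v ⬝ᵥ u = 1 := by
  rw [vecMulVec_mul_vecMulVec, vecMulVec_smul] at h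
  exact smul_left_injective K (vecMulVec_ne_zero hu hv) (by simpa using h)

end RankOneMatrices

/-! ### Quadratic equations for block matrices -/

section BlockEquations

variable {K ι : Type*} [Field K] [Fintype ι] [DecidableEq ι]

/-- The block matrix with rows `(A, B)` and `(C, D)` is annihilated by the monic polynomial
`X ^ 2 - s X - p` for some scalars `s`, `p`; the condition is written out block by block. -/
def BlockQuadratic (A B C D : Matrix ι ι K) : Prop :=
  ∃ s p : K, A * A + B * C = s • A + p • (1 : Matrix ι ι K) ∧ A * B + B * D = s • B ∧
    C * A + D * C = s • C ∧ C * B + D * D = s • D + p • (1 : Matrix ι ι K)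

lemma BlockQuadratic.transpose {A B C D : Matrix ι ι K} (h : BlockQuadratic A B C D) :
    BlockQuadratic Aᵀ Cᵀ Bᵀ Dᵀ := by
  obtain ⟨s, p, h1, h2, h3, h4⟩ := h
  refine ⟨s, p, ?_, ?_, ?_, ?_⟩
  · simpa using congrArg Matrix.transpose h1
  · rw [← transpose_smul, ← h3]; simp [transpose_add, transpose_mul]
  · rw [← transpose_smul, ← h2]; simp [transpose_add, transpose_mul]
  · simpa using congrArg Matrix.transpose h4

lemma BlockQuadratic.smul {A B C D : Matrix ι ι K} (h : BlockQuadratic A B C D) (c : K) :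
    BlockQuadratic (c • A) (c • B) (c • C) (c • D) := by
  obtain ⟨s, p, h1, h2, h3, h4⟩ := h
  refine ⟨c * s, c * c * p, ?_, ?_, ?_, ?_⟩
  · simp only [smul_mul_smul_comm, ← smul_add, h1]
    simp only [smul_add, smul_smul]; ring_nf
  · simp only [smul_mul_smul_comm, ← smul_add, h2, smul_smul]; ring_nf
  · simp only [smul_mul_smul_comm, ← smul_add, h3, smul_smul]; ring_nf
  · simp only [smul_mul_smul_comm, ← smul_add, h4]
    simp only [smul_add, smul_smul]; ring_nf

/-- The left multiples `E_ij Z` of a nonzero `Z` are single rows placed at will, so they cannot all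
lie in the span of `Z` and `1` once the size is at least `3`. -/
lemma eq_zero_of_forall_mul_mem (hι : 3 ≤ Fintype.card ι) (Z : Matrix ι ι K)
    (h : ∀ W : Matrix ι ι K, ∃ s p : K, W * Z = s • Z + p • (1 : Matrix ι ι K)) : Z = 0 := by
  by_contra hZ
  obtain ⟨j, k, hjk⟩ : ∃ j k, Z j k ≠ 0 := by
    by_contra! hc
    exact hZ (by ext a b; exact hc a b)
  obtain ⟨i, hi⟩ : ∃ i, i ∉ ({k} : Finset ι) := by
    by_contra! hc
    have := Finset.card_le_card (fun a _ => hc a : (Finset.univ : Finset ι) ⊆ {k})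
    rw [Finset.card_univ, Finset.card_singleton] at this
    omega
  obtain ⟨i', hi'⟩ : ∃ i', i' ∉ ({i, k} : Finset ι) := by
    by_contra! hc
    have := Finset.card_le_card (fun a _ => hc a : (Finset.univ : Finset ι) ⊆ {i, k})
    have h2 := Finset.card_le_two (a := i) (b := k)
    rw [Finset.card_univ] at this
    omega
  simp only [Finset.mem_insert, Finset.mem_singleton, not_or] at hi hi'
  obtain ⟨s, p, hs⟩ := h (single i j 1)
  obtain ⟨s', p', hs'⟩ := h (single i' j 1)
  have e1 : Z j k = s * Z i k := by
    simpa [Matrix.one_apply, hi] using congrFun (congrFun hs i) k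
  have e2 : s' * Z i k = 0 := by
    have := congrFun (congrFun hs' i) k
    rw [single_mul_apply_of_ne _ _ _ _ _ (Ne.symm hi'.1)] at this
    simpa [Matrix.one_apply, hi, eq_comm] using this
  have e3 : Z j k = s' * Z i' k := by
    simpa [Matrix.one_apply, hi'] using congrFun (congrFun hs' i') k
  have hik : Z i k ≠ 0 := by
    intro h0
    exact hjk (by rw [e1, h0, mul_zero])
  have : s' = 0 := by simpa [hik] using e2
  exact hjk (by rw [e3, this, zero_mul])

lemma blockQuadratic_scalar (c : K) (B : Matrix ι ι K) :
    BlockQuadratic (c • (1 : Matrix ι ι K)) B 0 0 :=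
  ⟨c, 0, by simp, by simp, by simp, by simp⟩

lemma exists_scalar_of_blockQuadratic_one {A : Matrix ι ι K} (h : BlockQuadratic A 1 0 0) :
    ∃ c : K, A = c • (1 : Matrix ι ι K) := by
  obtain ⟨s, p, -, h2, -, -⟩ := h
  exact ⟨s, by simpa using h2⟩

lemma eq_zero_of_smul_one_eq_zero [Nonempty ι] {c : K} (h : c • (1 : Matrix ι ι K) = 0) : c = 0 := by
  simpa using h

lemma smul_one_inj [Nonempty ι] {c d : K} (h : c • (1 : Matrix ι ι K) = d • 1) : c = d := by
  have := eq_zero_of_smul_one_eq_zero (c := c - d) (by rw [sub_smul, h, sub_self])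
  exact sub_eq_zero.1 this

end BlockEquations

/-! ### Unital preservers: idempotents and column spaces -/

section UnitalPreservers

variable {K ι : Type*} [Field K] [Fintype ι]

/-- `R` lies below `S` when every idempotent that kills `S` from the left kills `R` from the left;
this says that the column space of `R` is contained in that of `S`. -/
def ColumnLE (R S : Matrix ι ι K) : Prop :=
  ∀ P : Matrix ι ι K, P * P = P → P * S = 0 → P * R = 0

lemma columnLE_vecMulVec (u v w : ι → K) (hw : w ≠ 0) :
    ColumnLE (vecMulVec u v) (vecMulVec u w) := by
  intro P _ h
  rw [mul_vecMulVec, vecMulVec_eq_zero] at h ⊢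
  exact Or.inl (h.resolve_right hw)

variable [DecidableEq ι]

lemma ColumnLE.exists_eq_vecMulVec {R : Matrix ι ι K} {u w : ι → K} (hu : u ≠ 0)
    (h : ColumnLE R (vecMulVec u w)) : ∃ v, R = vecMulVec u v := by
  -- a functional vanishing at `u` vanishes on every column `r` of `R`: otherwise it is a multiple
  -- of some `f` with `f r = 1`, and the idempotent `r ⊗ f` kills `u ⊗ w` but not `R`
  have key : ∀ f : ι → K, f ⬝ᵥ u = 0 → f ᵥ* R = 0 := by
    intro f hf
    by_contra hne
    obtain ⟨j, hj⟩ := Function.ne_iff.1 hne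
    have hc : f ⬝ᵥ R.col j ≠ 0 := hj
    have hP := h (vecMulVec (R.col j) ((f ⬝ᵥ R.col j)⁻¹ • f))
      (by rw [vecMulVec_mul_vecMulVec, smul_dotProduct, smul_eq_mul, inv_mul_cancel₀ hc, one_smul])
      (by rw [vecMulVec_mul_vecMulVec, smul_dotProduct, hf, smul_zero, zero_smul, vecMulVec_zero])
    rw [vecMulVec_mul, vecMulVec_eq_zero, smul_vecMul, smul_eq_zero] at hP
    rcases hP with h0 | h0 | h0
    · rw [h0, dotProduct_zero] at hc; exact hc rfl
    · exact hc (inv_eq_zero.1 h0)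
    · exact hne h0
  obtain ⟨i, hi⟩ := Function.ne_iff.1 hu
  have hi' : u i ≠ 0 := hi
  refine ⟨fun j => R i j / u i, ?_⟩
  ext k j
  have := congrFun (key (u i • Pi.single k 1 - u k • Pi.single i 1) (by
    rw [sub_dotProduct, smul_dotProduct, smul_dotProduct, single_one_dotProduct,
      single_one_dotProduct, smul_eq_mul, smul_eq_mul, mul_comm, sub_self])) j
  rw [sub_vecMul, smul_vecMul, smul_vecMul, single_one_vecMul, single_one_vecMul] at this
  have e : u i * R k j - u k * R i j = 0 := by simpa using this
  rw [vecMulVec_apply]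
  field_simp
  linear_combination e

/-- A permutation of the matrices that preserves quadratic `2 × 2` block matrices in both
directions and fixes `0` and `1`. -/
structure IsUnitalPreserver (φ : Matrix ι ι K ≃ Matrix ι ι K) : Prop where
  quadratic : ∀ A B C D, BlockQuadratic (φ A) (φ B) (φ C) (φ D) ↔ BlockQuadratic A B C D
  map_zero : φ 0 = 0
  map_one : φ 1 = 1

namespace IsUnitalPreserver

variable {φ : Matrix ι ι K ≃ Matrix ι ι K}

lemma symm (hφ : IsUnitalPreserver φ) : IsUnitalPreserver φ.symm where
  quadratic A B C D := by
    rw [← hφ.quadratic]; simp only [Equiv.apply_symm_apply]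
  map_zero := by rw [Equiv.symm_apply_eq, hφ.map_zero]
  map_one := by rw [Equiv.symm_apply_eq, hφ.map_one]

lemma quadratic_transpose (A B C D : Matrix ι ι K) :
    BlockQuadratic Aᵀ Cᵀ Bᵀ Dᵀ ↔ BlockQuadratic A B C D :=
  ⟨fun h => by simpa using h.transpose, fun h => h.transpose⟩

/-- Conjugating a preserver by transposition exchanges statements on column spaces and on row
spaces. -/
lemma transpose (hφ : IsUnitalPreserver φ) :
    IsUnitalPreserver (((transposeAddEquiv ι ι K).toEquiv.trans φ).trans
      (transposeAddEquiv ι ι K).toEquiv) where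
  quadratic A B C D := by
    change BlockQuadratic (φ Aᵀ)ᵀ (φ Bᵀ)ᵀ (φ Cᵀ)ᵀ (φ Dᵀ)ᵀ ↔ _
    rw [quadratic_transpose, hφ.quadratic, quadratic_transpose]
  map_zero := by
    change (φ 0ᵀ)ᵀ = 0
    rw [transpose_zero, hφ.map_zero, transpose_zero]
  map_one := by
    change (φ 1ᵀ)ᵀ = 1
    rw [transpose_one, hφ.map_one, transpose_one]

lemma map_eq_zero (hφ : IsUnitalPreserver φ) {A : Matrix ι ι K} : φ A = 0 ↔ A = 0 := by
  rw [← hφ.map_zero, φ.apply_eq_iff_eq, hφ.map_zero]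

lemma map_eq_one (hφ : IsUnitalPreserver φ) {A : Matrix ι ι K} : φ A = 1 ↔ A = 1 := by
  rw [← hφ.map_one, φ.apply_eq_iff_eq, hφ.map_one]

lemma exists_scalar (hφ : IsUnitalPreserver φ) (c : K) :
    ∃ d : K, φ (c • 1) = d • 1 := by
  refine exists_scalar_of_blockQuadratic_one ?_
  have := (hφ.quadratic _ _ _ _).2 (blockQuadratic_scalar c (1 : Matrix ι ι K))
  rwa [hφ.map_one, hφ.map_zero] at this

lemma isIdempotent [Nonempty ι] (hφ : IsUnitalPreserver φ) {P : Matrix ι ι K} (hP : P * P = P) :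
    φ P * φ P = φ P := by
  have q1 : BlockQuadratic P 0 0 1 := ⟨1, 0, by simp [hP], by simp, by simp, by simp⟩
  have q2 : BlockQuadratic P P 0 0 := ⟨1, 0, by simp [hP], by simp [hP], by simp, by simp⟩
  rw [← hφ.quadratic] at q1 q2
  rw [hφ.map_zero, hφ.map_one] at q1
  rw [hφ.map_zero] at q2
  obtain ⟨s, p, h1, -, -, h4⟩ := q1
  obtain ⟨t, -, -, h2, -, -⟩ := q2
  have hs : 1 = s + p := smul_one_inj (ι := ι) (by simpa [add_smul] using h4)
  have h1' : φ P * φ P = s • φ P + p • (1 : Matrix ι ι K) := by simpa using h1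
  have h2' : φ P * φ P = t • φ P := by simpa using h2
  by_cases hst : t = s
  · have hp : p = 0 := by
      refine eq_zero_of_smul_one_eq_zero (ι := ι) ?_
      rw [h2', hst] at h1'
      simpa using h1'
    rw [h2', hst]
    rw [hp, add_zero] at hs
    rw [← hs, one_smul]
  · -- `φ P` satisfies two different quadratic equations, so it is a scalar, and so is `P`
    have hsc : φ P = (p / (t - s)) • (1 : Matrix ι ι K) := by
      have h3 : (t - s) • φ P = p • (1 : Matrix ι ι K) := by
        rw [sub_smul, ← h2', h1', add_sub_cancel_left]
      rw [div_eq_inv_mul, mul_smul, ← h3, inv_smul_smul₀ (sub_ne_zero.2 hst)]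
    obtain ⟨d, hd⟩ := hφ.symm.exists_scalar (p / (t - s))
    rw [← hsc, Equiv.symm_apply_apply] at hd
    have hdd : d * d = d := by
      refine smul_one_inj (ι := ι) ?_
      rw [hd, smul_mul_smul_comm, one_mul] at hP
      exact hP
    rcases IsIdempotentElem.iff_eq_zero_or_one.1 hdd with h0 | h0
    · rw [h0, zero_smul] at hd
      rw [hd, hφ.map_zero, mul_zero]
    · rw [h0, one_smul] at hd
      rw [hd, hφ.map_one, mul_one]

lemma mul_eq_zero_of_isIdempotent [Nonempty ι] (hφ : IsUnitalPreserver φ) {P B : Matrix ι ι K}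
    (hP : P * P = P) (hB : P * B = 0) : φ P * φ B = 0 := by
  have q : BlockQuadratic P B 0 1 := ⟨1, 0, by simp [hP], by simp [hB], by simp, by simp⟩
  rw [← hφ.quadratic, hφ.map_zero, hφ.map_one] at q
  obtain ⟨s, p, h1, h2, -, h4⟩ := q
  have hs : 1 = s + p := smul_one_inj (ι := ι) (by simpa [add_smul] using h4)
  by_cases h : s = 1
  · rw [h] at h2
    simpa using h2
  · have hP1 : φ P = 1 := by
      have h3 : (1 - s) • φ P = (1 - s) • (1 : Matrix ι ι K) := by
        have h1' : φ P = s • φ P + p • (1 : Matrix ι ι K) := by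
          simpa [hφ.isIdempotent hP] using h1
        rw [sub_smul, one_smul]
        nth_rewrite 1 [h1']
        rw [add_sub_cancel_left, hs, add_sub_cancel_left]
      exact smul_right_injective _ (sub_ne_zero.2 (Ne.symm h)) h3
    rw [hφ.map_eq_one] at hP1
    rw [hP1, one_mul] at hB
    rw [hB, hφ.map_zero, mul_zero]

lemma columnLE [Nonempty ι] (hφ : IsUnitalPreserver φ) {R S : Matrix ι ι K}
    (h : ColumnLE R S) : ColumnLE (φ R) (φ S) := by
  intro P hP hS
  have h1 := hφ.symm.isIdempotent hP
  have h2 := hφ.symm.mul_eq_zero_of_isIdempotent hP hS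
  rw [Equiv.symm_apply_apply] at h2
  have := hφ.mul_eq_zero_of_isIdempotent h1 (h _ h1 h2)
  rwa [Equiv.apply_symm_apply] at this

/-- Matrices of rank one are those whose column space is minimal, so a preserver permutes them. -/
lemma exists_eq_vecMulVec [Nonempty ι] (hφ : IsUnitalPreserver φ) {u v : ι → K} (hu : u ≠ 0)
    (hv : v ≠ 0) : ∃ a b, a ≠ 0 ∧ b ≠ 0 ∧ φ (vecMulVec u v) = vecMulVec a b := by
  have hne : φ (vecMulVec u v) ≠ 0 := by
    rw [Ne, hφ.map_eq_zero]; exact vecMulVec_ne_zero hu hv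
  obtain ⟨i, j, hij⟩ : ∃ i j, φ (vecMulVec u v) i j ≠ 0 := by
    by_contra! hc
    exact hne (by ext i j; exact hc i j)
  set a := (φ (vecMulVec u v)).col j with ha
  have ha0 : a ≠ 0 := fun h => hij (congrFun h i)
  have h1 : ColumnLE (vecMulVec a v) (φ (vecMulVec u v)) := by
    intro P _ hP
    rw [mul_vecMulVec]
    have : P *ᵥ a = 0 := by
      ext k; exact congrFun (congrFun hP k) j
    rw [this, zero_vecMulVec]
  have h2 := hφ.symm.columnLE h1
  rw [Equiv.symm_apply_apply] at h2
  obtain ⟨w, hw⟩ := h2.exists_eq_vecMulVec hu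
  have hw0 : w ≠ 0 := by
    rintro rfl
    rw [vecMulVec_zero, hφ.symm.map_eq_zero] at hw
    exact vecMulVec_ne_zero ha0 hv hw
  have h3 := hφ.columnLE (columnLE_vecMulVec u v w hw0)
  rw [← hw, Equiv.apply_symm_apply] at h3
  obtain ⟨b, hb⟩ := h3.exists_eq_vecMulVec ha0
  refine ⟨a, b, ha0, ?_, hb⟩
  rintro rfl
  rw [vecMulVec_zero] at hb
  exact hne hb

lemma exists_eq_vecMulVec_left [Nonempty ι] (hφ : IsUnitalPreserver φ) {u v w a b : ι → K}
    (hw : w ≠ 0) (ha : a ≠ 0) (h : φ (vecMulVec u w) = vecMulVec a b) :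
    ∃ c, φ (vecMulVec u v) = vecMulVec a c := by
  have := hφ.columnLE (columnLE_vecMulVec u v w hw)
  rw [h] at this
  exact this.exists_eq_vecMulVec ha

lemma exists_eq_vecMulVec_right [Nonempty ι] (hφ : IsUnitalPreserver φ) {u v w a b : ι → K}
    (hu : u ≠ 0) (hb : b ≠ 0) (h : φ (vecMulVec u w) = vecMulVec a b) :
    ∃ c, φ (vecMulVec v w) = vecMulVec c b := by
  have h' : (φ (vecMulVec w u)ᵀ)ᵀ = vecMulVec b a := by
    rw [transpose_vecMulVec, h, transpose_vecMulVec]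
  obtain ⟨c, hc⟩ := hφ.transpose.exists_eq_vecMulVec_left (v := v) hu hb h'
  have hc' : (φ (vecMulVec w v)ᵀ)ᵀ = vecMulVec b c := hc
  refine ⟨c, ?_⟩
  rw [transpose_vecMulVec] at hc'
  rw [← transpose_transpose (φ _), hc', transpose_vecMulVec]

end IsUnitalPreserver

end UnitalPreservers

/-! ### Unital preservers are semilinear similarities -/

section RankOne

variable {K ι : Type*} [Field K] [Fintype ι] [DecidableEq ι]

namespace IsUnitalPreserver

variable {φ : Matrix ι ι K ≃ Matrix ι ι K}

/-- On matrices of rank at most one a preserver acts on the column vector and on the row vector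
separately. The two maps are read off from one column and one row of a grid of rank-one matrices;
the quadratic block matrix `(x₀ ⊗ f₀, x₀ ⊗ g; y ⊗ f₀, y ⊗ g)` fixes the scalar factor. -/
lemma exists_map_vecMulVec [Nontrivial ι] (hφ : IsUnitalPreserver φ) :
    ∃ a b : (ι → K) → (ι → K), ∀ y g, φ (vecMulVec y g) = vecMulVec (a y) (b g) := by
  obtain ⟨i₀⟩ : Nonempty ι := inferInstance
  set e : ι → K := Pi.single i₀ 1 with he
  have hee : e ⬝ᵥ e = 1 := by simp [he]
  have he0 : e ≠ 0 := by rw [he, Ne, Pi.single_eq_zero_iff]; exact one_ne_zero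
  obtain ⟨a₀, h₀, ha₀, hh₀, hφe⟩ := hφ.exists_eq_vecMulVec he0 he0
  have hone : h₀ ⬝ᵥ a₀ = 1 := by
    refine dotProduct_eq_one_of_isIdempotent ha₀ hh₀ ?_
    rw [← hφe]
    exact hφ.isIdempotent (by rw [vecMulVec_mul_vecMulVec, hee, one_smul])
  choose a ha using fun y => hφ.exists_eq_vecMulVec_right (v := y) he0 hh₀ hφe
  choose b hb using fun g => hφ.exists_eq_vecMulVec_left (v := g) he0 ha₀ hφe
  refine ⟨a, b, fun y g => ?_⟩
  rcases eq_or_ne y 0 with rfl | hy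
  · have : a 0 = 0 := by
      have := ha 0
      rw [zero_vecMulVec, hφ.map_zero, eq_comm, vecMulVec_eq_zero] at this
      exact this.resolve_right hh₀
    rw [this, zero_vecMulVec, zero_vecMulVec, hφ.map_zero]
  rcases eq_or_ne g 0 with rfl | hg
  · have : b 0 = 0 := by
      have := hb 0
      rw [vecMulVec_zero, hφ.map_zero, eq_comm, vecMulVec_eq_zero] at this
      exact this.resolve_left ha₀
    rw [this, vecMulVec_zero, vecMulVec_zero, hφ.map_zero]
  have hay : a y ≠ 0 := by
    intro h
    have := ha y
    rw [h, zero_vecMulVec, hφ.map_eq_zero] at this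
    exact vecMulVec_ne_zero hy he0 this
  have hbg : b g ≠ 0 := by
    intro h
    have := hb g
    rw [h, vecMulVec_zero, hφ.map_eq_zero] at this
    exact vecMulVec_ne_zero he0 hg this
  obtain ⟨k, hk⟩ := hφ.exists_eq_vecMulVec_left (v := g) he0 hay (ha y)
  obtain ⟨k', hk'⟩ := hφ.exists_eq_vecMulVec_right (v := y) he0 hbg (hb g)
  obtain ⟨c, hc⟩ : ∃ c : K, φ (vecMulVec y g) = c • vecMulVec (a y) (b g) := by
    obtain ⟨j, hj⟩ := Function.ne_iff.1 hbg
    refine ⟨k j / b g j, ?_⟩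
    have hj' : b g j ≠ 0 := hj
    have : k' = (k j / b g j) • a y := by
      ext i
      have := congrFun (congrFun (hk.symm.trans hk') i) j
      rw [vecMulVec_apply, vecMulVec_apply] at this
      rw [Pi.smul_apply, smul_eq_mul]
      field_simp
      linear_combination -this
    rw [hk', this, smul_vecMulVec]
  have q : BlockQuadratic (vecMulVec e e) (vecMulVec e g) (vecMulVec y e) (vecMulVec y g) := by
    refine ⟨1 + g ⬝ᵥ y, 0, ?_, ?_, ?_, ?_⟩ <;>
    · simp only [vecMulVec_mul_vecMulVec, hee, vecMulVec_smul]
      module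
  rw [← hφ.quadratic, hφe, ha, hb, hc] at q
  obtain ⟨s, p, h1, h2, -, h4⟩ := q
  simp only [vecMulVec_mul_vecMulVec, vecMulVec_smul, smul_mul_assoc, mul_smul_comm, hone] at h1 h2 h4
  set t := b g ⬝ᵥ a y with ht
  have h1' : (1 + t - s) • vecMulVec a₀ h₀ = p • (1 : Matrix ι ι K) := by
    linear_combination (norm := module) h1
  have hp : p = 0 := by
    rw [← smul_vecMulVec] at h1'
    exact eq_zero_of_vecMulVec_eq_smul_one h1'
  have h2' : (1 + c * t - s) • vecMulVec a₀ (b g) = 0 := by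
    linear_combination (norm := module) h2
  have e2 := (smul_eq_zero.1 h2').resolve_right (vecMulVec_ne_zero ha₀ hbg)
  have h4' : (1 + c * c * t - s * c) • vecMulVec (a y) (b g) = 0 := by
    rw [hp] at h4
    linear_combination (norm := module) h4
  have e4 := (smul_eq_zero.1 h4').resolve_right (vecMulVec_ne_zero hay hbg)
  have : c = 1 := by linear_combination -e4 + c * e2
  rw [hc, this, one_smul]

/-- A preserver acts on matrices of rank at most one as a field automorphism applied to the
entries, followed by a similarity. The automorphism `τ` is the function with
`b g ⬝ᵥ a y = τ (g ⬝ᵥ y)`, which is well defined because, for nonzero vectors,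
`(x ⊗ f, 0; 0, y ⊗ g)` is quadratic exactly when `f ⬝ᵥ x = g ⬝ᵥ y`. -/
lemma exists_ringEquiv_map_vecMulVec [Nontrivial ι] (hφ : IsUnitalPreserver φ) :
    ∃ (A B : Matrix ι ι K) (τ : K ≃+* K), A * B = 1 ∧
      ∀ u v, φ (vecMulVec u v) = vecMulVec (A *ᵥ (τ ∘ u)) ((τ ∘ v) ᵥ* B) := by
  obtain ⟨a, b, hab⟩ := hφ.exists_map_vecMulVec
  have hne : ∀ {y g : ι → K}, y ≠ 0 → g ≠ 0 → a y ≠ 0 ∧ b g ≠ 0 := by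
    intro y g hy hg
    have := vecMulVec_ne_zero hy hg
    rw [Ne, ← hφ.map_eq_zero, hab, vecMulVec_eq_zero, not_or] at this
    exact this
  obtain ⟨i₀, j₀, hij⟩ := exists_pair_ne ι
  have hs0 : ∀ (i : ι) {c : K}, c ≠ 0 → (Pi.single i c : ι → K) ≠ 0 := fun i c hc => by
    rwa [Ne, Pi.single_eq_zero_iff]
  have hzero : ∀ {y g : ι → K}, g ⬝ᵥ y = 0 → b g ⬝ᵥ a y = 0 := by
    intro y g h
    by_cases hg : g = 0
    · have := hab (Pi.single i₀ 1) 0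
      rw [vecMulVec_zero, hφ.map_zero, eq_comm, vecMulVec_eq_zero] at this
      rw [hg, this.resolve_left (hne (hs0 i₀ one_ne_zero) (hs0 i₀ one_ne_zero)).1, zero_dotProduct]
    obtain ⟨j, hj⟩ := Function.ne_iff.1 hg
    have hj' : g j ≠ 0 := hj
    -- complete `g` to an idempotent
    have hP : vecMulVec (Pi.single j (g j)⁻¹) g * vecMulVec (Pi.single j (g j)⁻¹) g =
        vecMulVec (Pi.single j (g j)⁻¹) g := by
      rw [vecMulVec_mul_vecMulVec, dotProduct_single, mul_inv_cancel₀ hj', one_smul]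
    have := hφ.mul_eq_zero_of_isIdempotent (B := vecMulVec y g) hP (by
      rw [vecMulVec_mul_vecMulVec, h, zero_smul, vecMulVec_zero])
    obtain ⟨h1, h2⟩ := hne (hs0 j (inv_ne_zero hj')) hg
    rw [hab, hab, vecMulVec_mul_vecMulVec, vecMulVec_smul, smul_eq_zero] at this
    exact this.resolve_right (vecMulVec_ne_zero h1 h2)
  have hpair : ∀ {x f y g : ι → K}, x ≠ 0 → f ≠ 0 → y ≠ 0 → g ≠ 0 → f ⬝ᵥ x = g ⬝ᵥ y →
      b f ⬝ᵥ a x = b g ⬝ᵥ a y := by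
    intro x f y g hx hf hy hg h
    have q : BlockQuadratic (vecMulVec x f) 0 0 (vecMulVec y g) := by
      refine ⟨f ⬝ᵥ x, 0, ?_, by simp, by simp, ?_⟩
      · simp [vecMulVec_mul_vecMulVec, vecMulVec_smul]
      · simp [vecMulVec_mul_vecMulVec, vecMulVec_smul, h]
    rw [← hφ.quadratic, hφ.map_zero, hab, hab] at q
    obtain ⟨s, p, h1, -, -, h4⟩ := q
    simp only [vecMulVec_mul_vecMulVec, vecMulVec_smul, mul_zero, add_zero, zero_add] at h1 h4
    have h1' : (b f ⬝ᵥ a x - s) • vecMulVec (a x) (b f) = p • (1 : Matrix ι ι K) := by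
      linear_combination (norm := module) h1
    have h4' : (b g ⬝ᵥ a y - s) • vecMulVec (a y) (b g) = p • (1 : Matrix ι ι K) := by
      linear_combination (norm := module) h4
    have hp : p = 0 := by
      rw [← smul_vecMulVec] at h1'
      exact eq_zero_of_vecMulVec_eq_smul_one h1'
    rw [hp, zero_smul, smul_eq_zero] at h1' h4'
    have e1 := h1'.resolve_right (vecMulVec_ne_zero (hne hx hf).1 (hne hx hf).2)
    have e4 := h4'.resolve_right (vecMulVec_ne_zero (hne hy hg).1 (hne hy hg).2)
    linear_combination e1 - e4
  let τ : K → K := fun t => b (Pi.single i₀ 1) ⬝ᵥ a (Pi.single i₀ t)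
  have hτ : ∀ g y, b g ⬝ᵥ a y = τ (g ⬝ᵥ y) := by
    intro g y
    by_cases h : g ⬝ᵥ y = 0
    · rw [hzero h, h]
      exact (hzero (by simp)).symm
    · refine hpair ?_ ?_ (hs0 _ h) (hs0 _ one_ne_zero) (by simp)
      · rintro rfl; simp at h
      · rintro rfl; simp at h
  have hτ0 : τ 0 = 0 := hzero (by simp)
  have hτ1 : τ 1 = 1 := by
    have he := hs0 i₀ (one_ne_zero (α := K))
    refine dotProduct_eq_one_of_isIdempotent (hne he he).1 (hne he he).2 ?_
    rw [← hab]
    exact hφ.isIdempotent (by rw [vecMulVec_mul_vecMulVec]; simp)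
  let A : Matrix ι ι K := of fun i j => a (Pi.single j 1) i
  let B : Matrix ι ι K := of fun i j => b (Pi.single i 1) j
  have hBA : B * A = 1 := by
    ext i j
    have : (B * A) i j = b (Pi.single i 1) ⬝ᵥ a (Pi.single j 1) := rfl
    rw [this, hτ, single_one_dotProduct, Pi.single_apply, one_apply]
    split_ifs <;> assumption
  have hAB : A * B = 1 := mul_eq_one_comm.1 hBA
  have hBa : ∀ x, B *ᵥ a x = τ ∘ x := by
    intro x
    ext i
    have : (B *ᵥ a x) i = b (Pi.single i 1) ⬝ᵥ a x := rfl
    rw [this, hτ, single_one_dotProduct, Function.comp_apply]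
  have hbA : ∀ g, b g ᵥ* A = τ ∘ g := by
    intro g
    ext i
    have : (b g ᵥ* A) i = b g ⬝ᵥ a (Pi.single i 1) := rfl
    rw [this, hτ, dotProduct_single_one, Function.comp_apply]
  have ha : ∀ x, a x = A *ᵥ (τ ∘ x) := fun x => by
    rw [← hBa, mulVec_mulVec, hAB, one_mulVec]
  have hb : ∀ g, b g = (τ ∘ g) ᵥ* B := fun g => by
    rw [← hbA, vecMul_vecMul, hAB, vecMul_one]
  have hdot : ∀ g x : ι → K, τ (g ⬝ᵥ x) = (τ ∘ g) ⬝ᵥ (τ ∘ x) := by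
    intro g x
    rw [← hτ, ha, hb, dotProduct_mulVec, vecMul_vecMul, hBA, vecMul_one]
  have hsingle : ∀ (i : ι) (t : K), τ ∘ (Pi.single i t : ι → K) = Pi.single i (τ t) := by
    intro i t
    ext k
    simp only [Function.comp_apply, Pi.single_apply]
    split_ifs
    · rfl
    · exact hτ0
  have hmul : ∀ s t, τ (s * t) = τ s * τ t := by
    intro s t
    have := hdot (Pi.single i₀ s) (Pi.single i₀ t)
    simpa [hsingle] using this
  have hadd : ∀ s t, τ (s + t) = τ s + τ t := by
    intro s t
    have hpair' : ∀ s t : K, τ ∘ (Pi.single i₀ s + Pi.single j₀ t : ι → K) =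
        Pi.single i₀ (τ s) + Pi.single j₀ (τ t) := by
      intro s t
      ext k
      rcases eq_or_ne k i₀ with rfl | hk
      · simp [hij]
      · rcases eq_or_ne k j₀ with rfl | hk'
        · simp [hk]
        · simp [hk, hk', hτ0]
    have := hdot (Pi.single i₀ 1 + Pi.single j₀ 1) (Pi.single i₀ s + Pi.single j₀ t)
    rw [hpair', hpair', hτ1] at this
    simpa [add_dotProduct, hij, hij.symm] using this
  let τ' : K →+* K :=
    { toFun := τ, map_one' := hτ1, map_mul' := hmul, map_zero' := hτ0, map_add' := hadd }
  have hsurj : Function.Surjective τ' := by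
    intro μ
    have he := hs0 i₀ (one_ne_zero (α := K))
    have h1 : φ.symm (vecMulVec (a (Pi.single i₀ 1)) (b (Pi.single i₀ 1))) =
        vecMulVec (Pi.single i₀ 1) (Pi.single i₀ 1) := by
      rw [← hab, Equiv.symm_apply_apply]
    obtain ⟨y, hy⟩ := hφ.symm.exists_eq_vecMulVec_right (v := A *ᵥ Pi.single i₀ μ)
      (hne he he).1 he h1
    rw [Equiv.symm_apply_eq, hab] at hy
    have hay : A *ᵥ Pi.single i₀ μ = a y := by
      obtain ⟨j, hj⟩ := Function.ne_iff.1 (hne he he).2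
      ext i
      exact mul_right_cancel₀ hj (congrFun (congrFun hy i) j)
    refine ⟨y i₀, ?_⟩
    have := congrFun (hBa y) i₀
    rw [← hay, mulVec_mulVec, hBA, one_mulVec, Pi.single_eq_same] at this
    exact this.symm
  refine ⟨A, B, RingEquiv.ofBijective τ' ⟨τ'.injective, hsurj⟩, hAB, fun u v => ?_⟩
  rw [hab, ha, hb]
  rfl

/-- Unital preservers are semilinear similarities. The values on rank-one matrices determine the
rest: for `f ⬝ᵥ T y = 1` the block matrix `(T y ⊗ f, T; -y ⊗ f, -y ⊗ f T)` has square zero, and its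
image can only be quadratic if `φ T` acts on the row vector corresponding to `f` as expected. -/
theorem exists_similarity [Nontrivial ι] (hφ : IsUnitalPreserver φ) :
    ∃ (A B : Matrix ι ι K) (τ : K ≃+* K), A * B = 1 ∧ ∀ T, φ T = A * T.map τ * B := by
  obtain ⟨A, B, τ, hAB, h⟩ := hφ.exists_ringEquiv_map_vecMulVec
  have hBA : B * A = 1 := mul_eq_one_comm.1 hAB
  refine ⟨A, B, τ, hAB, fun T => ?_⟩
  have hdot : ∀ u v : ι → K, ((τ ∘ v) ᵥ* B) ⬝ᵥ (A *ᵥ (τ ∘ u)) = τ (v ⬝ᵥ u) := by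
    intro u v
    rw [dotProduct_mulVec, vecMul_vecMul, hBA, vecMul_one]
    exact (RingHom.map_dotProduct (τ : K →+* K) v u).symm
  have key : ∀ f : ι → K, f ᵥ* T ≠ 0 → (τ ∘ f) ᵥ* (B * φ T * A - T.map τ) = 0 := by
    intro f hf
    obtain ⟨j, hj⟩ := Function.ne_iff.1 hf
    have hj' : (f ᵥ* T) j ≠ 0 := hj
    set y : ι → K := Pi.single j ((f ᵥ* T) j)⁻¹ with hy
    have hfy : f ᵥ* T ⬝ᵥ y = 1 := by rw [hy, dotProduct_single, mul_inv_cancel₀ hj']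
    have hfx : f ⬝ᵥ T *ᵥ y = 1 := by rw [dotProduct_mulVec, hfy]
    have hf0 : f ≠ 0 := by rintro rfl; simp at hf
    have hy0 : -y ≠ 0 := by rw [neg_ne_zero]; rintro h0; simp [h0] at hfy
    have hfy' : f ᵥ* T ⬝ᵥ -y = -1 := by rw [dotProduct_neg, hfy]
    have q : BlockQuadratic (vecMulVec (T *ᵥ y) f) T (vecMulVec (-y) f)
        (vecMulVec (-y) (f ᵥ* T)) := by
      refine ⟨0, 0, ?_, ?_, ?_, ?_⟩
      · rw [vecMulVec_mul_vecMulVec, hfx, mul_vecMulVec, mulVec_neg, neg_vecMulVec]; simp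
      · rw [vecMulVec_mul, mul_vecMulVec, mulVec_neg, neg_vecMulVec]; simp
      · rw [vecMulVec_mul_vecMulVec, vecMulVec_mul_vecMulVec, hfx, hfy', neg_one_smul,
          vecMulVec_neg]
        simp
      · rw [vecMulVec_mul, vecMulVec_mul_vecMulVec, hfy', neg_one_smul, vecMulVec_neg]; simp
    rw [← hφ.quadratic, h, h, h] at q
    obtain ⟨s, p, -, -, h3, h4⟩ := q
    have hne : vecMulVec (A *ᵥ (τ ∘ (-y))) ((τ ∘ f) ᵥ* B) ≠ 0 := by
      rw [← h, Ne, hφ.map_eq_zero]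
      exact vecMulVec_ne_zero hy0 hf0
    rw [vecMulVec_mul_vecMulVec, vecMulVec_mul_vecMulVec, hdot, hdot, hfx, hfy', _root_.map_one, map_neg,
      _root_.map_one, ← vecMulVec_add, ← add_smul, add_neg_cancel, zero_smul, vecMulVec_zero, eq_comm,
      smul_eq_zero] at h3
    have hs := h3.resolve_right hne
    rw [vecMulVec_mul, vecMulVec_mul_vecMulVec, hdot, hfy', map_neg, _root_.map_one, hs, zero_smul,
      zero_add, ← vecMulVec_add] at h4
    have hp := eq_zero_of_vecMulVec_eq_smul_one h4
    rw [hp, zero_smul, vecMulVec_eq_zero] at h4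
    rw [Ne, vecMulVec_eq_zero, not_or] at hne
    have h5 := h4.resolve_left hne.1
    rw [neg_one_smul, add_neg_eq_zero] at h5
    have h6 : τ ∘ (f ᵥ* T) = (τ ∘ f) ᵥ* T.map τ := by
      ext i; exact RingHom.map_vecMul (τ : K →+* K) T f i
    rw [vecMul_sub, ← vecMul_vecMul, ← vecMul_vecMul, h5, vecMul_vecMul, hBA, vecMul_one, h6,
      sub_self]
  have hΔ : B * φ T * A - T.map τ = 0 := by
    rcases eq_or_ne T 0 with rfl | hT
    · rw [hφ.map_zero]; simp
    obtain ⟨k, hk⟩ : ∃ k, (Pi.single k 1 : ι → K) ᵥ* T ≠ 0 := by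
      by_contra! hc
      refine hT (Matrix.ext fun i j => ?_)
      have := congrFun (hc i) j
      rwa [single_one_vecMul] at this
    have hrow : ∀ i, (τ ∘ (Pi.single i 1 : ι → K)) ᵥ* (B * φ T * A - T.map τ) = 0 := by
      intro i
      by_cases hi : (Pi.single i 1 : ι → K) ᵥ* T = 0
      · have h1 := key (Pi.single k 1 + Pi.single i 1) (by rwa [add_vecMul, hi, add_zero])
        have h2 : τ ∘ (Pi.single k 1 + Pi.single i 1 : ι → K) =
            τ ∘ (Pi.single k 1 : ι → K) + τ ∘ (Pi.single i 1 : ι → K) := by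
          ext; simp
        rwa [h2, add_vecMul, key _ hk, zero_add] at h1
      · exact key _ hi
    ext i j
    have h1 : τ ∘ (Pi.single i 1 : ι → K) = Pi.single i 1 := by
      ext k; simp [Pi.single_apply, apply_ite τ]
    have := congrFun (hrow i) j
    rwa [h1, single_one_vecMul] at this
  rw [← sub_eq_zero.1 hΔ, mul_assoc, mul_assoc, mul_assoc, hAB, mul_one, ← mul_assoc, hAB, one_mul]

end IsUnitalPreserver

end RankOne

/-! ### Reduction to the unital case -/

section Normalization

variable {K ι : Type*} [Field K] [Fintype ι] [DecidableEq ι]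

/-- A bijection that preserves quadratic `2 × 2` block matrices fixes `0` and sends `1` to a
nonzero scalar matrix; dividing by that scalar makes it unital. -/
lemma exists_smul_isUnitalPreserver (hι : 3 ≤ Fintype.card ι) (φ : Matrix ι ι K ≃ Matrix ι ι K)
    (hφ : ∀ A B C D, BlockQuadratic A B C D ↔ BlockQuadratic (φ A) (φ B) (φ C) (φ D)) :
    ∃ (c : K) (ψ : Matrix ι ι K ≃ Matrix ι ι K), c ≠ 0 ∧ IsUnitalPreserver ψ ∧
      ∀ T, φ T = c • ψ T := by
  have hzero : φ 0 = 0 := by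
    refine eq_zero_of_forall_mul_mem hι _ fun W => ?_
    have q : BlockQuadratic 0 (φ.symm (W - φ 0)) 0 0 := ⟨0, 0, by simp, by simp, by simp, by simp⟩
    rw [hφ, Equiv.apply_symm_apply] at q
    obtain ⟨s, p, h1, -⟩ := q
    exact ⟨s, p, by rw [← h1, sub_mul, add_sub_cancel]⟩
  obtain ⟨c, hc⟩ : ∃ c : K, φ 1 = c • 1 := by
    refine exists_scalar_of_blockQuadratic_one ?_
    have q := blockQuadratic_scalar (1 : K) (φ.symm 1)
    rwa [hφ, Equiv.apply_symm_apply, hzero, one_smul] at q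
  have : Nonempty ι := Fintype.card_pos_iff.1 (by omega)
  have hc0 : c ≠ 0 := by
    rintro rfl
    rw [zero_smul, ← hzero, φ.apply_eq_iff_eq] at hc
    exact one_ne_zero hc
  let σ : Matrix ι ι K ≃ Matrix ι ι K :=
    ⟨fun T => c⁻¹ • T, fun T => c • T, fun T => smul_inv_smul₀ hc0 T, fun T => inv_smul_smul₀ hc0 T⟩
  refine ⟨c, φ.trans σ, hc0, ⟨?_, ?_, ?_⟩, ?_⟩
  · intro A B C D
    change BlockQuadratic (c⁻¹ • φ A) (c⁻¹ • φ B) (c⁻¹ • φ C) (c⁻¹ • φ D) ↔ _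
    rw [hφ A B C D]
    refine ⟨fun h => ?_, fun h => h.smul c⁻¹⟩
    simpa only [smul_inv_smul₀ hc0] using h.smul c
  · change c⁻¹ • φ 0 = 0
    rw [hzero, smul_zero]
  · change c⁻¹ • φ 1 = 1
    rw [hc, inv_smul_smul₀ hc0]
  · intro T
    exact (smul_inv_smul₀ hc0 (φ T)).symm

end Normalization

/-! ### Quadratic matrices over the real and complex fields -/

section Quadratic

variable {F : Type*} [RCLike F]

/-- The inclusion `RCLike.map F ℂ` as a ring homomorphism. -/
noncomputable def RCLike.toComplexHom (F : Type*) [RCLike F] : F →+* ℂ where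
  toFun := RCLike.map F ℂ
  map_one' := by simp
  map_zero' := by simp
  map_add' x y := by simp; ring
  map_mul' x y := by
    apply Complex.ext <;> simp [RCLike.mul_re, RCLike.mul_im]

/-- The complex roots in the definition of a quadratic matrix may be replaced by coefficients in
`F`: unless `T` is scalar, the coefficients of its quadratic equation are rational functions of
the entries of `T`. -/
lemma isQuadraticMatrix_iff {ι : Type*} [Fintype ι] [DecidableEq ι] (T : Matrix ι ι F) :
    IsQuadraticMatrix T ↔ ∃ s p : F, T * T = s • T + p • (1 : Matrix ι ι F) := by
  set f := RCLike.toComplexHom F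
  change (∃ a b : ℂ, (T.map f - a • (1 : Matrix ι ι ℂ)) * (T.map f - b • (1 : Matrix ι ι ℂ)) = 0) ↔ _
  have hexp : ∀ a b : ℂ, (T.map f - a • (1 : Matrix ι ι ℂ)) * (T.map f - b • (1 : Matrix ι ι ℂ)) =
      (T * T).map f - ((a + b) • T.map f + (-(a * b)) • (1 : Matrix ι ι ℂ)) := by
    intro a b
    rw [Matrix.map_mul, sub_mul, mul_sub, mul_sub]
    simp only [mul_smul_comm, smul_mul_assoc, mul_one, one_mul]
    module
  simp only [hexp, sub_eq_zero]
  constructor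
  · rintro ⟨a, b, h⟩
    by_cases hsc : ∃ c : F, T = c • (1 : Matrix ι ι F)
    · obtain ⟨c, rfl⟩ := hsc
      exact ⟨c, 0, by simp⟩
    rcases isEmpty_or_nonempty ι with hι | ⟨⟨i₀⟩⟩
    · exact absurd ⟨0, Subsingleton.elim _ _⟩ hsc
    have hent : ∀ i j, f ((T * T) i j) = (a + b) * f (T i j) + -(a * b) * (1 : Matrix ι ι ℂ) i j :=
      fun i j => congrFun (congrFun h i) j
    obtain ⟨s, hs⟩ : ∃ s : F, f s = a + b := by
      by_cases hd : ∃ i j, i ≠ j ∧ T i j ≠ 0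
      · obtain ⟨i, j, hij, hT⟩ := hd
        refine ⟨(T * T) i j / T i j, ?_⟩
        have := hent i j
        rw [one_apply_ne hij, mul_zero, add_zero] at this
        rw [map_div₀, this, mul_div_cancel_right₀ _ ((map_ne_zero f).2 hT)]
      · push Not at hd
        obtain ⟨i, hi⟩ : ∃ i, T i i ≠ T i₀ i₀ := by
          by_contra! hc
          refine hsc ⟨T i₀ i₀, ?_⟩
          ext i j
          rcases eq_or_ne i j with rfl | hij
          · simp [hc]
          · simp [hij, hd i j hij]
        refine ⟨((T * T) i i - (T * T) i₀ i₀) / (T i i - T i₀ i₀), ?_⟩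
        have h1 := hent i i
        have h2 := hent i₀ i₀
        rw [one_apply_eq] at h1 h2
        have hne : f (T i i - T i₀ i₀) ≠ 0 := (map_ne_zero f).2 (sub_ne_zero.2 hi)
        rw [map_div₀, div_eq_iff hne, map_sub, map_sub]
        linear_combination h1 - h2
    have hp : f ((T * T) i₀ i₀ - s * T i₀ i₀) = -(a * b) := by
      have := hent i₀ i₀
      rw [one_apply_eq] at this
      rw [map_sub, map_mul, hs]
      linear_combination this
    refine ⟨s, (T * T) i₀ i₀ - s * T i₀ i₀, ?_⟩
    ext i j
    apply f.injective
    rw [hent, ← hs, ← hp]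
    simp [one_apply, apply_ite f]
  · rintro ⟨s, p, h⟩
    -- the roots of `X ^ 2 - s X - p`
    obtain ⟨d, hd⟩ := IsAlgClosed.exists_eq_mul_self (f s * f s + 4 * f p)
    refine ⟨(f s + d) / 2, (f s - d) / 2, ?_⟩
    have h1 : (f s + d) / 2 + (f s - d) / 2 = f s := by ring
    have h2 : -((f s + d) / 2 * ((f s - d) / 2)) = f p := by linear_combination (-1 / 4) * hd
    rw [h1, h2, h]
    ext i j
    simp [one_apply, apply_ite f]

lemma isQuadraticMatrix_comp_iff {m n : ℕ} (X : Matrix (Fin m) (Fin m) (Matrix (Fin n) (Fin n) F)) :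
    IsQuadraticMatrix (Matrix.comp (Fin m) (Fin m) (Fin n) (Fin n) F X) ↔
      ∃ s p : F, X * X = s • X + p • 1 := by
  rw [isQuadraticMatrix_iff]
  refine exists_congr fun s => exists_congr fun p => ?_
  set e := compAlgEquiv (Fin m) (Fin n) F F
  change e X * e X = s • e X + p • 1 ↔ _
  rw [← map_one e, ← map_mul, ← map_smul, ← map_smul, ← map_add, EmbeddingLike.apply_eq_iff_eq]

lemma isQuadraticMatrix_comp_two_iff {n : ℕ} (A B C D : Matrix (Fin n) (Fin n) F) :
    IsQuadraticMatrix (Matrix.comp (Fin 2) (Fin 2) (Fin n) (Fin n) F !![A, B; C, D]) ↔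
      BlockQuadratic A B C D := by
  rw [isQuadraticMatrix_comp_iff]
  refine exists_congr fun s => exists_congr fun p => ?_
  rw [← Matrix.ext_iff]
  simp [Fin.forall_fin_two, Matrix.mul_apply, Fin.sum_univ_two, and_assoc]

lemma preservesQuadratic_two_iff {n : ℕ} (φ : Matrix (Fin n) (Fin n) F → Matrix (Fin n) (Fin n) F) :
    PreservesQuadratic 2 φ ↔ ∀ A B C D,
      BlockQuadratic A B C D ↔ BlockQuadratic (φ A) (φ B) (φ C) (φ D) := by
  have hmap : ∀ A B C D, (!![A, B; C, D]).map φ = !![φ A, φ B; φ C, φ D] := by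
    intro A B C D
    ext i j : 2
    fin_cases i <;> fin_cases j <;> rfl
  constructor
  · intro h A B C D
    have := h !![A, B; C, D]
    rwa [hmap, isQuadraticMatrix_comp_two_iff, isQuadraticMatrix_comp_two_iff] at this
  · intro h X
    rw [eta_fin_two X, hmap, isQuadraticMatrix_comp_two_iff, isQuadraticMatrix_comp_two_iff, h]

end Quadratic

/-! ### Semilinear similarities preserve quadratic matrices -/

section Similarity

variable {K ι : Type*} [Field K] [Fintype ι] [DecidableEq ι]

/-- The ring endomorphism `T ↦ A T_τ A⁻¹` of the matrix ring, where `T_τ` is `T` with `τ` applied to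
the entries. -/
def semilinearConj (A : GL ι K) (τ : K ≃+* K) : Matrix ι ι K →+* Matrix ι ι K where
  toFun T := (A : Matrix ι ι K) * T.map τ * ((A⁻¹ : GL ι K) : Matrix ι ι K)
  map_one' := by simp [Matrix.map_one]
  map_zero' := by simp
  map_add' S T := by
    rw [Matrix.map_add _ (map_add τ), mul_add, add_mul]
  map_mul' S T := by
    rw [show (S * T).map τ = S.map τ * T.map τ from Matrix.map_mul (f := (τ : K →+* K))]
    simp only [mul_assoc, Units.inv_mul_cancel_left]

lemma semilinearConj_injective (A : GL ι K) (τ : K ≃+* K) :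
    Function.Injective (semilinearConj A τ) := by
  intro S T h
  have h1 : (A : Matrix ι ι K) * S.map τ * ((A⁻¹ : GL ι K) : Matrix ι ι K) =
    (A : Matrix ι ι K) * T.map τ * ((A⁻¹ : GL ι K) : Matrix ι ι K) := h
  rw [Units.mul_left_inj, Units.mul_right_inj] at h1
  exact Matrix.map_injective τ.injective h1

lemma semilinearConj_smul (A : GL ι K) (τ : K ≃+* K) (s : K) (T : Matrix ι ι K) :
    semilinearConj A τ (s • T) = τ s • semilinearConj A τ T := by
  have : (s • T).map τ = τ s • T.map τ := by ext; simp
  change (A : Matrix ι ι K) * (s • T).map τ * _ = τ s • (_ * _ * _)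
  rw [this, mul_smul_comm, smul_mul_assoc]

/-- Quadratic equations are transported by a nonzero multiple of a semilinear similarity applied
to each block. -/
lemma exists_quadratic_iff_map_smul_semilinearConj {m : Type*} [Fintype m] [DecidableEq m]
    (A : GL ι K) (τ : K ≃+* K) {c : K} (hc : c ≠ 0) (X : Matrix m m (Matrix ι ι K)) :
    (∃ s p : K, X * X = s • X + p • 1) ↔
      ∃ s p : K, X.map (fun T => c • semilinearConj A τ T) *
        X.map (fun T => c • semilinearConj A τ T) =
          s • X.map (fun T => c • semilinearConj A τ T) + p • 1 := by
  set Ψ := (semilinearConj A τ).mapMatrix (m := m) with hΨ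
  have hinj : Function.Injective Ψ := Matrix.map_injective (semilinearConj_injective A τ)
  have hsmul : ∀ (s : K) X, Ψ (s • X) = τ s • Ψ X := by
    intro s X
    refine Matrix.ext fun i j => ?_
    exact semilinearConj_smul A τ s (X i j)
  have hX : X.map (fun T => c • semilinearConj A τ T) = c • Ψ X := rfl
  rw [hX]
  constructor
  · rintro ⟨s, p, h⟩
    refine ⟨c * τ s, c * c * τ p, ?_⟩
    rw [smul_mul_smul_comm, ← map_mul, h, map_add, hsmul, hsmul, map_one]
    module
  · rintro ⟨s, p, h⟩
    refine ⟨τ.symm (c⁻¹ * s), τ.symm (c⁻¹ * c⁻¹ * p), hinj ?_⟩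
    rw [map_add, hsmul, hsmul, map_mul, map_one, RingEquiv.apply_symm_apply,
      RingEquiv.apply_symm_apply]
    have h1 : Ψ X * Ψ X = (c⁻¹ * c⁻¹) • ((c • Ψ X) * (c • Ψ X)) := by
      rw [smul_mul_smul_comm, smul_smul, mul_mul_mul_comm, inv_mul_cancel₀ hc, one_mul, one_smul]
    rw [h1, h, smul_add, smul_smul, smul_smul, smul_smul]
    congr 2
    field_simp

end Similarity

/-! ### The equivalence -/

theorem theorem1p2 {F : Type*} [RCLike F] (n : ℕ) (hn : 3 ≤ n)
    (φ : Matrix (Fin n) (Fin n) F → Matrix (Fin n) (Fin n) F) (hφ : Function.Bijective φ) :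
    List.TFAE [
      CompletelyPreservesQuadratic φ,
      PreservesQuadratic 2 φ,
      ∃ (A : GL (Fin n) F) (c : F) (τ : F ≃+* F), ∀ T : Matrix (Fin n) (Fin n) F,
        φ T = c • ((A : Matrix (Fin n) (Fin n) F) * T.map τ *
          ((A⁻¹ : GL (Fin n) F) : Matrix (Fin n) (Fin n) F))] := by
  have : Nontrivial (Fin n) := Fin.nontrivial_iff_two_le.2 (by omega)
  tfae_have 1 → 2 := fun h => h 2 (by norm_num)
  tfae_have 2 → 3 := by
    intro h
    rw [preservesQuadratic_two_iff] at h
    obtain ⟨c, ψ, -, hψ, hφψ⟩ :=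
      exists_smul_isUnitalPreserver (by simpa using hn) (Equiv.ofBijective φ hφ) h
    obtain ⟨A, B, τ, hAB, hA⟩ := hψ.exists_similarity
    refine ⟨⟨A, B, hAB, mul_eq_one_comm.1 hAB⟩, c, τ, fun T => ?_⟩
    rw [← Equiv.ofBijective_apply φ hφ, hφψ, hA]
    rfl
  tfae_have 3 → 1 := by
    rintro ⟨A, c, τ, h⟩ m - X
    have hc : c ≠ 0 := by
      -- otherwise `φ` would be constant
      rintro rfl
      exact one_ne_zero (hφ.1 (by rw [h, h, zero_smul, zero_smul]) :
        (1 : Matrix (Fin n) (Fin n) F) = 0)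
    have hφ' : φ = fun T => c • semilinearConj A τ T := funext h
    rw [isQuadraticMatrix_comp_iff, isQuadraticMatrix_comp_iff, hφ']
    exact exists_quadratic_iff_map_smul_semilinearConj A τ hc X
  tfae_finish
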